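/- **Theorem 3.1.** Let $\mathfrak g$ be a complex (finite-dimensional) simple Lie algebra with Cartan subalgebra $\mathfrak t$, root system $\Delta\subset\mathfrak t^*$, simple roots $\Pi$, positive roots $\Delta^+$ and Weyl group $W$. Let $\mathfrak g=\mathfrak g(-1)\oplus\mathfrak g(0)\oplus\mathfrak g(1)$ be an abelian $\mathbb Z$-grading, that is, a $\mathbb Z$-grading of the Lie algebra $\mathfrak g$ with $\mathfrak g(i)=0$ for $i\notin\{-1,0,1\}$, such that $\mathfrak t\subset\mathfrak g(0)$ and the root spaces of all simple roots lie in components of nonnegative degree. Let $\Delta(i)$ be the set of roots of $\mathfrak g(i)$ and $\Pi(0)=\Pi\cap\Delta(0)$. Partially order $\Delta(1)$ by: $\mu\preccurlyeq\gamma$ if and only if $\gamma-\mu$ is a nonnegative integer combination of elements of $\Pi(0)$. Write $\mathfrak{An}(\Delta(1))$ for the set of antichains of $\Delta(1)$, and $\min$, $\max$ for the sets of minimal and maximal elements of a subset of $\Delta(1)$. Let $W(0)\subset W$ be the Weyl group of $\Delta(0)$, and let $W^0\subset W$ be the set of elements of minimal length in their coset in $W/W(0)$. For $w\in W$ let $\ell(w)$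 be its length with respect to the simple reflections and $N(w)=\{\gamma\in\Delta^+\mid w(\gamma)\in-\Delta^+\}$ its inversion set. Put $$I_w=\Delta(1)\setminus N(w),\qquad \Gamma_w=\min(I_w).$$ Then $w\mapsto\Gamma_w$ is a bijection from $W^0$ onto $\mathfrak{An}(\Delta(1))$. Furthermore, for every $w\in W^0$: 1. $I_w$ is an upper ideal of $\Delta(1)$. 2. If $\gamma\in I_w$, then $\gamma\in\min(I_w)$ if and only if $w(\gamma)\in\Pi$; in other words, $\Gamma_w=w^{-1}(\Pi)\cap\Delta(1)$. 3. $N(w)\subset\Delta(1)$, and if $\gamma\in N(w)$, then $\gamma\in\max(N(w))$ if and only if $w(\gamma)\in-\Pi$; in other words, $\max(N(w))=\max(\Delta(1)\setminus I_w)=-w^{-1}(\Pi)\cap\Delta(1)$. 4. $\#I_w=\dim\mathfrak g(1)-\ell(w)$. In particular, $\#\mathfrak{An}(\Delta(1))=\#(W/W(0))$. -/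

import Mathlib

open LieAlgebra LieAlgebra.IsKilling Module
open scoped Pointwise

noncomputable section

namespace GradedRoots

variable {L : Type*} [LieRing L] [LieAlgebra ℂ L] [FiniteDimensional ℂ L] [IsKilling ℂ L]
variable {H : LieSubalgebra ℂ L} [H.IsCartanSubalgebra]

/-- The root system `Δ = Δ(𝔤, 𝔱)`, as a subset of `𝔱*`. -/
def roots (H : LieSubalgebra ℂ L) [H.IsCartanSubalgebra] : Set (Dual ℂ H) :=
  Set.range (rootSystem H).root

/-- The set `Π` of simple roots of a base. -/
def simpleRoots (b : (rootSystem H).Base) : Set (Dual ℂ H) :=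
  (rootSystem H).root '' b.support

/-- The set `Δ⁺` of positive roots: the roots that are nonnegative integer combinations of simple
roots. -/
def posRoots (b : (rootSystem H).Base) : Set (Dual ℂ H) :=
  {γ | γ ∈ roots H ∧ γ ∈ AddSubmonoid.closure (simpleRoots b)}

/-- The Weyl group `W` of `Δ`; it acts on `𝔱*`. -/
abbrev Weyl (H : LieSubalgebra ℂ L) [H.IsCartanSubalgebra] : Type _ :=
  (rootSystem H).weylGroup

/-- The inversion set `N(w)`: the positive roots that `w` sends to negative roots. -/
def inversions (b : (rootSystem H).Base) (w : Weyl H) : Set (Dual ℂ H) :=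
  {γ | γ ∈ posRoots b ∧ w • γ ∈ -posRoots b}

/-- The reflections of `W` in the simple roots. -/
def simpleReflections (b : (rootSystem H).Base) : Set (Weyl H) :=
  RootPairing.weylGroup.ofIdx (rootSystem H) '' b.support

/-- The length `ℓ(w)`: the least number of factors in an expression of `w` as a product of simple
reflections. -/
def length (b : (rootSystem H).Base) (w : Weyl H) : ℕ :=
  sInf {n | ∃ l : List (Weyl H), (∀ s ∈ l, s ∈ simpleReflections b) ∧ l.prod = w ∧ l.length = n}

/-- For a grading `𝔤 = ⨁ 𝔤(i)` with `𝔱 ⊆ 𝔤(0)`, the set `Δ(i)` of roots of `𝔤(i)`: the roots whose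
(one-dimensional) root space lies in `𝔤(i)`. -/
def gradedRoots (H : LieSubalgebra ℂ L) [H.IsCartanSubalgebra] (𝓖 : ℤ → Submodule ℂ L) (i : ℤ) :
    Set (Dual ℂ H) :=
  {γ | γ ∈ roots H ∧ (rootSpace H γ).toSubmodule ≤ 𝓖 i}

/-- The set `Π(i) = Π ∩ Δ(i)`. -/
def gradedSimpleRoots (b : (rootSystem H).Base) (𝓖 : ℤ → Submodule ℂ L) (i : ℤ) :
    Set (Dual ℂ H) :=
  simpleRoots b ∩ gradedRoots H 𝓖 i

/-- `W(0)`, the Weyl group of `Δ(0)`, as the subgroup of `W` generated by the reflections in the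
roots of `Δ(0)`. -/
def weylZero (H : LieSubalgebra ℂ L) [H.IsCartanSubalgebra] (𝓖 : ℤ → Submodule ℂ L) :
    Subgroup (Weyl H) :=
  Subgroup.closure (RootPairing.weylGroup.ofIdx (rootSystem H) ''
    {j | (rootSystem H).root j ∈ gradedRoots H 𝓖 0})

/-- `W⁰`: the elements of `W` that have minimal length in their coset in `W/W(0)`. -/
def minReps (b : (rootSystem H).Base) (𝓖 : ℤ → Submodule ℂ L) : Set (Weyl H) :=
  {w | ∀ v : Weyl H, (v : Weyl H ⧸ weylZero H 𝓖) = (w : Weyl H ⧸ weylZero H 𝓖) →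
    length b w ≤ length b v}

/-- The poset `Δ(i)` of `𝔱`-weights of the `𝔤(0)`-module `𝔤(i)`, for `i ≠ 0`;
its order, defined below, depends on the simple roots of the base. -/
def WeightPoset (_b : (rootSystem H).Base) (𝓖 : ℤ → Submodule ℂ L) (i : ℤ) : Type _ :=
  {γ : Dual ℂ H // γ ∈ gradedRoots H 𝓖 i}

theorem eq_zero_or_pos_of_mem_closure (b : (rootSystem H).Base) (f : Dual ℂ (Dual ℂ H))
    (hf : ∀ α ∈ simpleRoots b, f α = 1) {x : Dual ℂ H}
    (hx : x ∈ AddSubmonoid.closure (simpleRoots b)) : x = 0 ∨ ∃ n : ℕ, 0 < n ∧ f x = n := by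
  induction hx using AddSubmonoid.closure_induction with
  | mem x hx => exact Or.inr ⟨1, one_pos, by simpa using hf x hx⟩
  | zero => exact Or.inl rfl
  | add x y _ _ hx hy =>
    rcases hx with rfl | ⟨n, hn, h⟩
    · simpa using hy
    · rcases hy with rfl | ⟨m, hm, h'⟩
      · exact Or.inr ⟨n, hn, by simpa using h⟩
      · exact Or.inr ⟨n + m, by omega, by simp [h, h']⟩

theorem eq_zero_of_mem_closure_of_neg_mem (b : (rootSystem H).Base) {x : Dual ℂ H}
    (hx : x ∈ AddSubmonoid.closure (simpleRoots b))
    (hx' : -x ∈ AddSubmonoid.closure (simpleRoots b)) : x = 0 := by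
  let f : Dual ℂ (Dual ℂ H) := b.toWeightBasis.constr ℂ (fun _ => (1 : ℂ))
  have hf : ∀ α ∈ simpleRoots b, f α = 1 := by
    rintro _ ⟨i, hi, rfl⟩
    have := b.toWeightBasis.constr_basis ℂ (fun _ => (1 : ℂ)) ⟨i, hi⟩
    rwa [RootPairing.Base.toWeightBasis_apply] at this
  rcases eq_zero_or_pos_of_mem_closure b f hf hx with h | ⟨n, hn, h⟩
  · exact h
  rcases eq_zero_or_pos_of_mem_closure b f hf hx' with h' | ⟨m, hm, h'⟩
  · simpa using h'
  · exfalso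
    rw [map_neg, h] at h'
    have : ((n + m : ℕ) : ℂ) = 0 := by push_cast; rw [← neg_eq_iff_add_eq_zero]; exact h'
    have := Nat.cast_eq_zero.mp this
    omega

/-- The weight order of the `𝔤(0)`-module `𝔤(i)`: `μ ≼ γ` if and only if `γ - μ` is a nonnegative
integer combination of the simple roots `Π(0)` of `𝔤(0)`. -/
instance (b : (rootSystem H).Base) (𝓖 : ℤ → Submodule ℂ L) (i : ℤ) :
    PartialOrder (WeightPoset b 𝓖 i) where
  le μ γ := γ.1 - μ.1 ∈ AddSubmonoid.closure (gradedSimpleRoots b 𝓖 0)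
  le_refl μ := by simp
  le_trans μ ν γ h h' := by simpa using add_mem h' h
  le_antisymm μ γ h h' := by
    have hs := AddSubmonoid.closure_mono
      (Set.inter_subset_left : gradedSimpleRoots b 𝓖 0 ⊆ simpleRoots b)
    have := eq_zero_of_mem_closure_of_neg_mem b (hs h) (by rw [neg_sub]; exact hs h')
    exact Subtype.ext (sub_eq_zero.mp this).symm

/-- The set `min S` of minimal elements of a subset of a poset. -/
def minElts {X : Type*} [PartialOrder X] (S : Set X) : Set X := {x | Minimal (· ∈ S) x}

/-- The set `max S` of maximal elements of a subset of a poset. -/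
def maxElts {X : Type*} [PartialOrder X] (S : Set X) : Set X := {x | Maximal (· ∈ S) x}

/-- For a subset `S` of `𝔱*`, the subset `S ∩ Δ(1)` of the poset `Δ(1)`. -/
def inDeltaOne (b : (rootSystem H).Base) (𝓖 : ℤ → Submodule ℂ L) (S : Set (Dual ℂ H)) :
    Set (WeightPoset b 𝓖 1) :=
  {γ | γ.1 ∈ S}

/-- `I_w = Δ(1) ∖ N(w)`. -/
def idealOf (b : (rootSystem H).Base) (𝓖 : ℤ → Submodule ℂ L) (w : Weyl H) :
    Set (WeightPoset b 𝓖 1) :=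
  (inDeltaOne b 𝓖 (inversions b w))ᶜ

/-- `Γ_w = min (Δ(1) ∖ N(w))`. -/
def antichainOf (b : (rootSystem H).Base) (𝓖 : ℤ → Submodule ℂ L) (w : Weyl H) :
    Set (WeightPoset b 𝓖 1) :=
  minElts (idealOf b 𝓖 w)

/-- The set of antichains of a poset. -/
def antichains (X : Type*) [PartialOrder X] : Set (Set X) := {A | IsAntichain (· ≤ ·) A}

end GradedRoots

end

/-!
The grading is inner: the derivation that multiplies `𝔤(i)` by `i` is `ad x` for some `x` in the
Cartan subalgebra `𝔱` (`exists_isGradingElement`), so the degree of a root `γ` is `γ x`. It is an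
additive function on the roots with values in `{-1, 0, 1}` and is nonnegative on the simple roots,
and everything but the equality `dim 𝔤(1) = #Δ(1)` (`IsGradingElement.finrank_eq`) is a statement
on root systems.

The exchange condition (`exists_word_mul_refl`) gives `ℓ(w) = #N(w)` (`ncard_inversions`), and an
element without inversions is `1`, so that `w` is determined by `N(w)`. The group `W(0)` preserves
degrees. Hence `w` has minimal length in `w W(0)` if and only if it keeps the positive roots of
degree zero positive, that is, `N(w) ⊆ Δ(1)` (`IsDegreeElement.mem_minReps_iff`), and each coset
contains exactly one such `w`.

For such `w`, a root `γ` of `I_w` is minimal if and only if `w γ` is simple. If `w γ` is simple and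
`μ ≺ γ`, with both in `I_w`, then `w γ = w μ + w (γ - μ)` is a sum of two nonzero elements of the
positive cone, which is absurd. If `w γ` is a sum of two positive roots, then `γ` is a sum of two
roots, of degrees one and zero because the grading is abelian, and the first of them is a smaller
element of `I_w` (`IsDegreeElement.exists_split`). The maximal elements of `N(w)` are treated in
the same way.

Removing from `I_w` a minimal element `γ`, with `w γ = α` simple, gives the ideal of `s_α w`
(`IsDegreeElement.idealOf_refl_mul`), so by induction every upper ideal of `Δ(1)` is some `I_w`.
Upper ideals of a finite poset correspond to antichains through their minimal elements.
-/

namespace GradedRoots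

variable {L : Type*} [LieRing L] [LieAlgebra ℂ L] [FiniteDimensional ℂ L] [IsKilling ℂ L]
variable {H : LieSubalgebra ℂ L} [H.IsCartanSubalgebra]

/-! ### Positive roots and the action of the Weyl group -/

theorem root_mem_roots (i : H.root) : (rootSystem H).root i ∈ roots H := ⟨i, rfl⟩

theorem ne_zero_of_mem_roots {γ : Dual ℂ H} (hγ : γ ∈ roots H) : γ ≠ 0 := by
  obtain ⟨i, rfl⟩ := hγ
  exact (rootSystem H).ne_zero i

theorem finite_roots : (roots H).Finite := Set.finite_range _

theorem neg_mem_roots {γ : Dual ℂ H} (hγ : γ ∈ roots H) : -γ ∈ roots H :=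
  (rootSystem H).neg_mem_range_root_iff.mpr hγ

theorem smul_mem_roots (w : Weyl H) {γ : Dual ℂ H} (hγ : γ ∈ roots H) : w • γ ∈ roots H := by
  obtain ⟨i, rfl⟩ := hγ
  rw [RootPairing.weylGroup_apply_root]
  exact root_mem_roots _

theorem mem_roots_of_smul_mem (w : Weyl H) {γ : Dual ℂ H} (hγ : w • γ ∈ roots H) :
    γ ∈ roots H := by
  simpa using smul_mem_roots w⁻¹ hγ

theorem simpleRoots_subset_posRoots (b : (rootSystem H).Base) : simpleRoots b ⊆ posRoots b := by
  rintro γ ⟨i, hi, rfl⟩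
  exact ⟨root_mem_roots i, AddSubmonoid.subset_closure ⟨i, hi, rfl⟩⟩

theorem mem_posRoots_or_neg_mem (b : (rootSystem H).Base) {γ : Dual ℂ H} (hγ : γ ∈ roots H) :
    γ ∈ posRoots b ∨ -γ ∈ posRoots b := by
  obtain ⟨i, rfl⟩ := hγ
  exact (b.root_mem_or_neg_mem i).imp (fun h ↦ ⟨root_mem_roots i, h⟩)
    (fun h ↦ ⟨neg_mem_roots (root_mem_roots i), h⟩)

theorem neg_notMem_posRoots {b : (rootSystem H).Base} {γ : Dual ℂ H} (hγ : γ ∈ posRoots b) :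
    -γ ∉ posRoots b := fun h ↦
  ne_zero_of_mem_roots hγ.1 (eq_zero_of_mem_closure_of_neg_mem b hγ.2 h.2)

theorem neg_mem_posRoots_iff {b : (rootSystem H).Base} {γ : Dual ℂ H} (hγ : γ ∈ roots H) :
    -γ ∈ posRoots b ↔ γ ∉ posRoots b :=
  ⟨fun h h' ↦ neg_notMem_posRoots h' h, (mem_posRoots_or_neg_mem b hγ).resolve_left⟩

/-- The positive roots of `posRoots` are those of Mathlib's `RootPairing.Base.IsPos`. -/
theorem root_mem_posRoots_iff (b : (rootSystem H).Base) (i : H.root) :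
    (rootSystem H).root i ∈ posRoots b ↔ b.IsPos i := by
  have key : ∀ j, b.IsPos j → (rootSystem H).root j ∈ posRoots b := fun j hj ↦
    hj.induction_on_add (fun k hk ↦ simpleRoots_subset_posRoots b ⟨k, hk, rfl⟩)
      fun k l m hm hk hl ↦ ⟨root_mem_roots m, by
        rw [hm]
        exact add_mem hk.2 (AddSubmonoid.subset_closure ⟨l, hl, rfl⟩)⟩
  refine ⟨fun h ↦ ?_, key i⟩
  let := (rootSystem H).indexNeg
  rcases RootPairing.Base.IsPos.or_neg b i with hi | hi
  · exact hi
  · have := key _ hi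
    rw [RootPairing.indexNeg_neg, RootPairing.root_reflectionPerm,
      RootPairing.reflection_apply_self] at this
    exact (neg_notMem_posRoots h this).elim

/-- A positive root that is not simple is a sum of two positive roots. -/
theorem exists_eq_add_of_notMem_simpleRoots {b : (rootSystem H).Base} {γ : Dual ℂ H}
    (hγ : γ ∈ posRoots b) (hs : γ ∉ simpleRoots b) :
    ∃ β₁ ∈ posRoots b, ∃ β₂ ∈ posRoots b, γ = β₁ + β₂ := by
  obtain ⟨i, rfl⟩ := hγ.1
  rw [root_mem_posRoots_iff] at hγ
  obtain ⟨j, hj, hj'⟩ := hγ.exists_mem_support_pos_pairingIn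
  rw [RootPairing.zero_lt_pairingIn_iff'] at hj'
  have hij : i ≠ j := by
    rintro rfl
    exact hs ⟨i, hj, rfl⟩
  obtain ⟨k, hk⟩ := RootPairing.root_sub_root_mem_of_pairingIn_pos _ hj' hij
  exact ⟨_, (root_mem_posRoots_iff b k).mpr (hγ.sub hj hk), _,
    simpleRoots_subset_posRoots b ⟨j, hj, rfl⟩, by rw [hk, sub_add_cancel]⟩

/-- A simple root is not a sum of two nonzero elements of the positive cone. -/
theorem eq_zero_or_eq_zero_of_add_mem_simpleRoots {b : (rootSystem H).Base} {x y : Dual ℂ H}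
    (hx : x ∈ AddSubmonoid.closure (simpleRoots b))
    (hy : y ∈ AddSubmonoid.closure (simpleRoots b)) (h : x + y ∈ simpleRoots b) :
    x = 0 ∨ y = 0 := by
  let f : Dual ℂ (Dual ℂ H) := b.toWeightBasis.constr ℂ (fun _ => (1 : ℂ))
  have hf : ∀ α ∈ simpleRoots b, f α = 1 := by
    rintro _ ⟨i, hi, rfl⟩
    have := b.toWeightBasis.constr_basis ℂ (fun _ => (1 : ℂ)) ⟨i, hi⟩
    rwa [RootPairing.Base.toWeightBasis_apply] at this
  rcases eq_zero_or_pos_of_mem_closure b f hf hx with h₁ | ⟨n, hn, h₁⟩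
  · exact Or.inl h₁
  rcases eq_zero_or_pos_of_mem_closure b f hf hy with h₂ | ⟨m, hm, h₂⟩
  · exact Or.inr h₂
  have h₃ := hf _ h
  rw [map_add, h₁, h₂] at h₃
  norm_cast at h₃
  omega

/-- The reflection in the `i`-th root, as an element of the Weyl group. -/
noncomputable abbrev refl (i : H.root) : Weyl H := RootPairing.weylGroup.ofIdx (rootSystem H) i

theorem refl_smul_root (i : H.root) :
    refl i • (rootSystem H).root i = -(rootSystem H).root i :=
  (rootSystem H).reflection_apply_self i

theorem refl_inv (i : H.root) : (refl i)⁻¹ = refl i :=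
  Subtype.ext (RootPairing.Equiv.reflection_inv _ i)

theorem refl_mul_self (i : H.root) : refl i * refl i = 1 := by
  nth_rewrite 1 [← refl_inv]
  exact inv_mul_cancel _

theorem refl_smul_refl_smul (i : H.root) (x : Dual ℂ H) : refl i • refl i • x = x := by
  rw [← mul_smul, refl_mul_self, one_smul]

/-- The Weyl group acts faithfully. -/
theorem weyl_ext {v w : Weyl H} (h : ∀ x : Dual ℂ H, v • x = w • x) : v = w :=
  Subtype.ext (RootPairing.Equiv.weightHom_injective _ (LinearEquiv.ext h))

/-- A simple reflection permutes the positive roots other than its own simple root. -/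
theorem refl_smul_mem_posRoots {b : (rootSystem H).Base} {i : H.root} (hi : i ∈ b.support)
    {γ : Dual ℂ H} (hγ : γ ∈ posRoots b) (hne : γ ≠ (rootSystem H).root i) :
    refl i • γ ∈ posRoots b := by
  obtain ⟨j, rfl⟩ := hγ.1
  have := ((root_mem_posRoots_iff b j).mp hγ).reflectionPerm hi (fun h ↦ hne (h ▸ rfl))
  rw [← root_mem_posRoots_iff] at this
  simpa [refl] using this

/-- Conjugating a reflection by `w` gives the reflection in the image of the root under `w`. -/
theorem mul_refl_mul_inv (w : Weyl H) (i : H.root) :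
    w * refl i * w⁻¹ = refl ((rootSystem H).weylGroupToPerm w i) := by
  obtain ⟨w, hw⟩ := w
  induction hw using RootPairing.weylGroup.induction generalizing i with
  | mem k =>
    refine weyl_ext fun x ↦ ?_
    change refl k • refl i • (refl k)⁻¹ • x = _
    rw [refl_inv]
    change _ = (rootSystem H).reflection ((rootSystem H).reflectionPerm k i) x
    rw [RootPairing.reflection_reflectionPerm]
    rfl
  | one =>
    have : (⟨1, one_mem _⟩ : Weyl H) = 1 := rfl
    rw [this, map_one, one_mul, inv_one, mul_one, Equiv.Perm.one_apply]
  | mul x y hx hy ihx ihy =>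
    have : (⟨x * y, mul_mem hx hy⟩ : Weyl H) = ⟨x, hx⟩ * ⟨y, hy⟩ := rfl
    rw [this, map_mul, Equiv.Perm.mul_apply, ← ihx, ← ihy]
    group

theorem refl_eq_of_smul_eq {w : Weyl H} {i j : H.root}
    (h : w • (rootSystem H).root i = (rootSystem H).root j) : w * refl i = refl j * w := by
  rw [RootPairing.weylGroup_apply_root] at h
  rw [← (rootSystem H).root.injective h, ← mul_refl_mul_inv, inv_mul_cancel_right]

/-! ### Length and inversions -/

theorem refl_mem_closure (b : (rootSystem H).Base) (i : H.root) :
    refl i ∈ Submonoid.closure (simpleReflections b) := by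
  have key : ∀ j k : H.root, refl ((rootSystem H).reflectionPerm j k) =
      refl j * refl k * refl j := fun j k ↦ by
    have := mul_refl_mul_inv (refl j) k
    rw [refl_inv] at this
    exact this.symm
  refine b.induction_reflect i (p := fun i ↦ refl i ∈ Submonoid.closure (simpleReflections b))
    (fun j hj ↦ ?_) (fun j hj ↦ Submonoid.subset_closure ⟨j, hj, rfl⟩) (fun k j hk hj ↦ ?_)
  · rw [key, refl_mul_self, one_mul]
    exact hj
  · have hj' : refl j ∈ Submonoid.closure (simpleReflections b) :=
      Submonoid.subset_closure ⟨j, hj, rfl⟩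
    rw [key]
    exact mul_mem (mul_mem hj' hk) hj'

/-- The simple reflections generate the Weyl group, even as a monoid. -/
theorem closure_simpleReflections (b : (rootSystem H).Base) :
    Submonoid.closure (simpleReflections b) = ⊤ := by
  refine eq_top_iff.mpr fun w _ ↦ ?_
  obtain ⟨w, hw⟩ := w
  induction hw using RootPairing.weylGroup.induction with
  | mem k => exact refl_mem_closure b k
  | one => exact one_mem _
  | mul x y hx hy ihx ihy => exact mul_mem (ihx trivial) (ihy trivial)

theorem exists_word_length_eq (b : (rootSystem H).Base) (w : Weyl H) :
    ∃ l : List (Weyl H), (∀ s ∈ l, s ∈ simpleReflections b) ∧ l.prod = w ∧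
      l.length = length b w := by
  obtain ⟨l, hl, hw⟩ := Submonoid.exists_list_of_mem_closure
    (s := simpleReflections b) (x := w) (by rw [closure_simpleReflections]; trivial)
  exact Nat.sInf_mem (s := {n | ∃ l : List (Weyl H), (∀ s ∈ l, s ∈ simpleReflections b) ∧
    l.prod = w ∧ l.length = n}) ⟨_, l, hl, hw, rfl⟩

theorem length_prod_le {b : (rootSystem H).Base} {l : List (Weyl H)}
    (hl : ∀ s ∈ l, s ∈ simpleReflections b) : length b l.prod ≤ l.length :=
  Nat.sInf_le ⟨l, hl, rfl, rfl⟩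

/-- The exchange condition: a word whose product makes the `i`-th simple root negative becomes a
word of the product with the `i`-th simple reflection by deleting one letter. -/
theorem exists_word_mul_refl {b : (rootSystem H).Base} {i : H.root} (l : List (Weyl H))
    (hl : ∀ s ∈ l, s ∈ simpleReflections b)
    (hi : i ∈ b.support) (hneg : l.prod • (rootSystem H).root i ∉ posRoots b) :
    ∃ l' : List (Weyl H), (∀ s ∈ l', s ∈ simpleReflections b) ∧
      l'.prod = l.prod * refl i ∧ l'.length + 1 = l.length := by
  induction l with
  | nil =>
    refine (hneg ?_).elim
    rw [List.prod_nil, one_smul]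
    exact simpleRoots_subset_posRoots b ⟨i, hi, rfl⟩
  | cons s l ih =>
    have hl' : ∀ s ∈ l, s ∈ simpleReflections b := fun t ht ↦ hl t (List.mem_cons_of_mem _ ht)
    by_cases hpos : l.prod • (rootSystem H).root i ∈ posRoots b
    · -- the letter `s` alone changes the sign, so it is the reflection in `l.prod • α i`
      obtain ⟨j, hj, rfl⟩ := hl s List.mem_cons_self
      refine ⟨l, hl', ?_, rfl⟩
      have h : l.prod • (rootSystem H).root i = (rootSystem H).root j := by
        by_contra hne
        refine hneg ?_
        rw [List.prod_cons, mul_smul]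
        exact refl_smul_mem_posRoots hj hpos hne
      rw [List.prod_cons, mul_assoc, refl_eq_of_smul_eq h, ← mul_assoc, refl_mul_self, one_mul]
    · obtain ⟨l', h₁, h₂, h₃⟩ := ih hl' hpos
      refine ⟨s :: l', ?_, by rw [List.prod_cons, h₂, List.prod_cons, mul_assoc], by simp [h₃]⟩
      intro t ht
      rcases List.mem_cons.mp ht with rfl | ht
      · exact hl t List.mem_cons_self
      · exact h₁ t ht

theorem mem_inversions_iff {b : (rootSystem H).Base} {w : Weyl H} {γ : Dual ℂ H} :
    γ ∈ inversions b w ↔ γ ∈ posRoots b ∧ w • γ ∉ posRoots b := by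
  refine and_congr_right fun h ↦ ?_
  rw [Set.mem_neg, neg_mem_posRoots_iff (smul_mem_roots w h.1)]

theorem finite_inversions (b : (rootSystem H).Base) (w : Weyl H) : (inversions b w).Finite :=
  finite_roots.subset fun _ h ↦ h.1.1

theorem inversions_one (b : (rootSystem H).Base) : inversions b (1 : Weyl H) = ∅ := by
  ext γ
  simp only [mem_inversions_iff, one_smul, Set.mem_empty_iff_false, iff_false]
  exact fun h ↦ h.2 h.1

/-- If `w` keeps the simple root `α` positive, then `N(w s_α) = {α} ∪ s_α N(w)`. -/
theorem inversions_mul_refl {b : (rootSystem H).Base} {w : Weyl H} {i : H.root}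
    (hi : i ∈ b.support) (hpos : w • (rootSystem H).root i ∈ posRoots b) :
    inversions b (w * refl i) =
      insert ((rootSystem H).root i) ((refl i • ·) '' inversions b w) := by
  have hα : (rootSystem H).root i ∈ posRoots b := simpleRoots_subset_posRoots b ⟨i, hi, rfl⟩
  ext γ
  rw [Set.mem_insert_iff, mem_inversions_iff, mul_smul]
  constructor
  · rintro ⟨h₁, h₂⟩
    by_cases hγ : γ = (rootSystem H).root i
    · exact Or.inl hγ
    · exact Or.inr ⟨refl i • γ,
        mem_inversions_iff.mpr ⟨refl_smul_mem_posRoots hi h₁ hγ, h₂⟩, refl_smul_refl_smul i γ⟩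
  · rintro (rfl | ⟨δ, hδ, rfl⟩)
    · refine ⟨hα, ?_⟩
      rw [refl_smul_root, smul_neg]
      exact neg_notMem_posRoots hpos
    · obtain ⟨h₁, h₂⟩ := mem_inversions_iff.mp hδ
      refine ⟨refl_smul_mem_posRoots hi h₁ ?_, ?_⟩
      · rintro rfl
        exact h₂ hpos
      · dsimp only
        rwa [refl_smul_refl_smul]

theorem ncard_inversions_mul_refl {b : (rootSystem H).Base} {w : Weyl H} {i : H.root}
    (hi : i ∈ b.support) (hpos : w • (rootSystem H).root i ∈ posRoots b) :
    (inversions b (w * refl i)).ncard = (inversions b w).ncard + 1 := by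
  rw [inversions_mul_refl hi hpos, Set.ncard_insert_of_notMem _ ((finite_inversions b w).image _),
    Set.ncard_image_of_injective _ (MulAction.injective _)]
  rintro ⟨δ, hδ, h⟩
  have hδ' : δ = -(rootSystem H).root i := by
    rw [← refl_smul_root, ← h]
    exact (refl_smul_refl_smul i δ).symm
  exact neg_notMem_posRoots (simpleRoots_subset_posRoots b ⟨i, hi, rfl⟩) (hδ' ▸ hδ.1)

/-- The length of `w` is the number of its inversions. -/
theorem ncard_inversions (b : (rootSystem H).Base) (w : Weyl H) :
    (inversions b w).ncard = length b w := by
  obtain ⟨l, hl, hw, hlen⟩ := exists_word_length_eq b w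
  subst hw
  rw [← hlen]
  induction l using List.reverseRecOn with
  | nil => simp [inversions_one]
  | append_singleton l s ih =>
    have hl' : ∀ s ∈ l, s ∈ simpleReflections b := fun t ht ↦ hl t (by simp [ht])
    obtain ⟨i, hi, rfl⟩ := hl s (by simp)
    have hprod : (l ++ [refl i]).prod = l.prod * refl i := by simp
    have hred : l.length = length b l.prod := by
      refine le_antisymm ?_ (length_prod_le hl')
      obtain ⟨m, hm, hm', hm''⟩ := exists_word_length_eq b l.prod
      have : length b (m ++ [refl i]).prod ≤ (m ++ [refl i]).length := by
        refine length_prod_le fun t ht ↦ ?_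
        rcases List.mem_append.mp ht with ht | ht
        · exact hm t ht
        · exact ⟨i, hi, (List.mem_singleton.mp ht).symm⟩
      rw [List.prod_append, List.prod_singleton, hm', ← hprod, ← hlen] at this
      simp only [List.length_append, List.length_singleton] at this
      omega
    have hpos : l.prod • (rootSystem H).root i ∈ posRoots b := by
      by_contra hneg
      obtain ⟨m, hm, hm', hm''⟩ := exists_word_mul_refl l hl' hi hneg
      have := length_prod_le hm
      rw [hm', ← hprod, ← hlen] at this
      simp only [List.length_append, List.length_singleton] at this
      omega
    rw [hprod, ncard_inversions_mul_refl hi hpos, ih hl' hred]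
    simp

theorem length_mul_refl_lt {b : (rootSystem H).Base} {w : Weyl H} {i : H.root}
    (hi : i ∈ b.support) (hneg : w • (rootSystem H).root i ∉ posRoots b) :
    length b (w * refl i) < length b w := by
  have hpos : (w * refl i) • (rootSystem H).root i ∈ posRoots b := by
    rw [mul_smul, refl_smul_root, smul_neg,
      neg_mem_posRoots_iff (smul_mem_roots w (root_mem_roots i))]
    exact hneg
  have := ncard_inversions_mul_refl hi hpos
  rw [mul_assoc, refl_mul_self, mul_one, ncard_inversions, ncard_inversions] at this
  omega

theorem eq_one_of_inversions_eq_empty {b : (rootSystem H).Base} {w : Weyl H}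
    (h : inversions b w = ∅) : w = 1 := by
  obtain ⟨l, -, rfl, hl⟩ := exists_word_length_eq b w
  rw [← ncard_inversions, h, Set.ncard_empty, List.length_eq_zero_iff] at hl
  rw [hl, List.prod_nil]

/-- An element of the Weyl group is determined by its inversion set. -/
theorem inversions_injective (b : (rootSystem H).Base) :
    Function.Injective (inversions b : Weyl H → Set (Dual ℂ H)) := by
  intro v w h
  have key : ∀ γ ∈ posRoots b, (v • γ ∈ posRoots b ↔ w • γ ∈ posRoots b) := fun γ hγ ↦ by
    have := Set.ext_iff.mp h γ
    simp only [mem_inversions_iff, hγ, true_and] at this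
    exact not_iff_not.mp this
  suffices h' : inversions b (w * v⁻¹) = ∅ from
    (mul_inv_eq_one.mp (eq_one_of_inversions_eq_empty h')).symm
  refine Set.eq_empty_iff_forall_notMem.mpr fun β hβ ↦ ?_
  obtain ⟨h₁, h₂⟩ := mem_inversions_iff.mp hβ
  rw [mul_smul] at h₂
  have hr : v⁻¹ • β ∈ roots H := smul_mem_roots _ h₁.1
  rcases mem_posRoots_or_neg_mem b hr with hp | hp
  · exact h₂ ((key _ hp).mp (by rwa [smul_inv_smul]))
  · have h₃ := (key _ hp).not.mp (by rw [smul_neg, smul_inv_smul]; exact neg_notMem_posRoots h₁)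
    rw [smul_neg, neg_mem_posRoots_iff (smul_mem_roots w hr)] at h₃
    exact h₃ h₂

/-! ### The grading element -/

/-- An element `x` of the Cartan subalgebra is a grading element of `𝓖` if `𝓖 i` consists of
eigenvectors of `ad x` of eigenvalue `i`, for every `i`. -/
def IsGradingElement (𝓖 : ℤ → Submodule ℂ L) (x : H) : Prop :=
  ∀ i, ∀ y ∈ 𝓖 i, ⁅(x : L), y⁆ = (i : ℂ) • y

/-- The derivation that multiplies each `𝓖 i` by `i` is inner, and its element centralizes, hence
belongs to, the Cartan subalgebra. -/
theorem exists_isGradingElement (𝓖 : ℤ → Submodule ℂ L) [GradedLieAlgebra 𝓖]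
    (hH : H.toSubmodule ≤ 𝓖 0) : ∃ x : H, IsGradingElement 𝓖 x := by
  obtain ⟨x, hx⟩ := LieDerivation.IsKilling.exists_eq_ad
    (LieDerivation.ofGrading 𝓖 (Int.castAddHom ℂ))
  have key : ∀ i, ∀ y ∈ 𝓖 i, ⁅x, y⁆ = (i : ℂ) • y := fun i y hy ↦ by
    rw [← LieDerivation.ad_apply_apply (R := ℂ), hx, LieDerivation.ofGrading_apply_apply 𝓖 _ hy]
    rfl
  refine ⟨⟨x, ?_⟩, key⟩
  have : x ∈ H.normalizer := (H.mem_normalizer_iff x).mpr fun y hy ↦ by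
    rw [key 0 y (hH hy), Int.cast_zero, zero_smul]
    exact H.zero_mem
  rwa [LieSubalgebra.IsCartanSubalgebra.self_normalizing] at this

theorem exists_ne_zero_mem_rootSpace {γ : Dual ℂ H} (hγ : γ ∈ roots H) :
    ∃ y : L, y ≠ 0 ∧ y ∈ rootSpace H γ := by
  obtain ⟨i, rfl⟩ := hγ
  obtain ⟨y, hy, hy'⟩ := (i : LieModule.Weight ℂ H L).exists_ne_zero
  exact ⟨y, hy', hy⟩

namespace IsGradingElement

variable {𝓖 : ℤ → Submodule ℂ L} [GradedLieAlgebra 𝓖] {x : H}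

omit [FiniteDimensional ℂ L] [IsKilling ℂ L] [H.IsCartanSubalgebra] in
theorem decompose_lie (hx : IsGradingElement 𝓖 x) (y : L) (j : ℤ) :
    (DirectSum.decompose 𝓖 ⁅(x : L), y⁆ j : L) = (j : ℂ) • (DirectSum.decompose 𝓖 y j : L) := by
  induction y using DirectSum.Decomposition.inductionOn 𝓖 with
  | zero => simp
  | @homogeneous i m =>
    rw [hx i m m.2, DirectSum.decompose_smul, DirectSum.smul_apply, Submodule.coe_smul]
    by_cases hij : i = j
    · subst hij
      rfl
    · rw [DirectSum.decompose_of_mem_ne 𝓖 m.2 hij, smul_zero, smul_zero]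
  | add m n hm hn =>
    rw [lie_add, DirectSum.decompose_add, DirectSum.decompose_add, DirectSum.add_apply,
      DirectSum.add_apply, Submodule.coe_add, Submodule.coe_add, hm, hn, smul_add]

omit [FiniteDimensional ℂ L] [IsKilling ℂ L] [H.IsCartanSubalgebra] in
/-- An eigenvector of the grading element is homogeneous, and its eigenvalue is its degree. -/
theorem exists_mem_of_lie_eq_smul (hx : IsGradingElement 𝓖 x) {y : L} (hy : y ≠ 0) {c : ℂ}
    (h : ⁅(x : L), y⁆ = c • y) : ∃ i : ℤ, c = i ∧ y ∈ 𝓖 i := by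
  have key : ∀ j : ℤ, c = j ∨ (DirectSum.decompose 𝓖 y j : L) = 0 := fun j ↦ by
    have := hx.decompose_lie y j
    rw [h, DirectSum.decompose_smul, DirectSum.smul_apply, Submodule.coe_smul, ← sub_eq_zero,
      ← sub_smul, smul_eq_zero, sub_eq_zero] at this
    exact this
  classical
  have hsum := DirectSum.sum_support_decompose 𝓖 y
  by_cases hc : ∃ i : ℤ, c = i
  · obtain ⟨i, rfl⟩ := hc
    refine ⟨i, rfl, ?_⟩
    rw [← hsum]
    refine sum_mem fun j _ ↦ ?_
    rcases key j with hj | hj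
    · rw [Int.cast_injective hj]
      exact Subtype.property _
    · rw [hj]
      exact zero_mem _
  · push Not at hc
    refine (hy ?_).elim
    rw [← hsum]
    exact Finset.sum_eq_zero fun j _ ↦ (key j).resolve_left (hc j)

theorem mem_gradedRoots_iff (hx : IsGradingElement 𝓖 x) {γ : Dual ℂ H} {i : ℤ} :
    γ ∈ gradedRoots H 𝓖 i ↔ γ ∈ roots H ∧ γ x = i := by
  refine and_congr_right fun hγ ↦ ⟨fun h ↦ ?_, fun h y hy ↦ ?_⟩
  · obtain ⟨y, hy, hy'⟩ := exists_ne_zero_mem_rootSpace hγ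
    have h₁ : ⁅(x : L), y⁆ = γ x • y := lie_eq_smul_of_mem_rootSpace hy' x
    rw [hx i y (h hy')] at h₁
    exact (smul_left_injective ℂ hy h₁).symm
  · by_cases hy0 : y = 0
    · rw [hy0]
      exact zero_mem _
    have h₁ : ⁅(x : L), y⁆ = γ x • y := lie_eq_smul_of_mem_rootSpace hy x
    obtain ⟨j, hj, hj'⟩ := hx.exists_mem_of_lie_eq_smul hy0 h₁
    rwa [← Int.cast_injective (h.symm.trans hj)] at hj'

theorem exists_mem_gradedRoots (hx : IsGradingElement 𝓖 x) {γ : Dual ℂ H} (hγ : γ ∈ roots H) :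
    ∃ i, γ ∈ gradedRoots H 𝓖 i := by
  obtain ⟨y, hy, hy'⟩ := exists_ne_zero_mem_rootSpace hγ
  obtain ⟨i, hi, -⟩ := hx.exists_mem_of_lie_eq_smul hy (lie_eq_smul_of_mem_rootSpace hy' x)
  exact ⟨i, hx.mem_gradedRoots_iff.mpr ⟨hγ, hi⟩⟩

/-- As root spaces are one-dimensional, the dimension of `𝓖 i` is the number of roots of
degree `i`, if `i ≠ 0`. -/
theorem finrank_eq (hx : IsGradingElement 𝓖 x) (hH : H.toSubmodule ≤ 𝓖 0) {i : ℤ} (hi : i ≠ 0) :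
    finrank ℂ (𝓖 i) = (gradedRoots H 𝓖 i).ncard := by
  let T : Set H.root := {α | (rootSystem H).root α ∈ gradedRoots H 𝓖 i}
  choose e he he' using fun α : T ↦ (α : LieModule.Weight ℂ H L).exists_ne_zero
  have hind : LinearIndependent ℂ e := by
    have h := LieSubmodule.iSupIndep_toSubmodule.mpr (LieModule.iSupIndep_genWeightSpace' ℂ H L)
    have h' := h.comp (f := fun α : T ↦ ((α : H.root) : LieModule.Weight ℂ H L))
      (Subtype.val_injective.comp Subtype.val_injective)
    exact h'.linearIndependent _ he he'
  have hspan : ∀ α : T, (rootSpace H (rootSystem H |>.root α)).toSubmodule ≤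
      Submodule.span ℂ (Set.range e) := fun α y hy ↦ by
    obtain ⟨c, hc⟩ := (finrank_eq_one_iff_of_nonzero'
      (⟨e α, he α⟩ : rootSpace H (α : LieModule.Weight ℂ H L)) (by simpa using he' α)).mp
      (finrank_rootSpace_eq_one _ (H.isNonZero_coe_root α)) ⟨y, hy⟩
    have hc' : c • e α = y := congrArg Subtype.val hc
    rw [← hc']
    exact Submodule.smul_mem _ _ (Submodule.subset_span ⟨α, rfl⟩)
  have hle : Submodule.span ℂ (Set.range e) ≤ 𝓖 i := by
    rw [Submodule.span_le]
    rintro _ ⟨α, rfl⟩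
    exact α.2.2 (he α)
  have htop : Submodule.span ℂ (Set.range e) ⊔ ⨆ (j) (_ : j ≠ i), 𝓖 j = ⊤ := by
    rw [eq_top_iff, ← LieSubmodule.top_toSubmodule (R := ℂ) (L := H) (M := L),
      ← LieModule.iSup_genWeightSpace_eq_top' ℂ H L, LieSubmodule.iSup_toSubmodule, iSup_le_iff]
    intro χ
    by_cases hχ : χ.IsZero
    · refine le_trans ?_ (le_sup_of_le_right (le_iSup₂_of_le 0 hi.symm hH))
      rw [hχ.eq]
      change (rootSpace H (0 : H → ℂ)).toSubmodule ≤ _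
      rw [rootSpace_zero_eq ℂ L H]
      exact le_rfl
    · have hχ' : χ ∈ H.root := by simpa using hχ
      obtain ⟨j, hj⟩ := hx.exists_mem_gradedRoots (root_mem_roots ⟨χ, hχ'⟩)
      by_cases hji : j = i
      · subst hji
        exact le_sup_of_le_left (hspan ⟨⟨χ, hχ'⟩, hj⟩)
      · exact le_sup_of_le_right (le_iSup₂_of_le j hji hj.2)
  -- the modular law cuts the decomposition `htop` down to `𝓖 i`
  have heq : Submodule.span ℂ (Set.range e) = 𝓖 i := by
    have hdisj := (DirectSum.Decomposition.isInternal 𝓖).submodule_iSupIndep i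
    have := sup_inf_assoc_of_le (⨆ (j) (_ : j ≠ i), 𝓖 j) hle
    rw [htop, top_inf_eq, inf_comm, hdisj.eq_bot, sup_bot_eq] at this
    exact this.symm
  have : Fintype T := Fintype.ofFinite _
  rw [← heq, finrank_span_eq_card hind, ← Nat.card_eq_fintype_card, Nat.card_coe_set_eq,
    ← Set.ncard_image_of_injective _ (rootSystem H).root.injective]
  congr 1
  ext γ
  constructor
  · rintro ⟨α, hα, rfl⟩
    exact hα
  · intro hγ
    obtain ⟨α, rfl⟩ := hγ.1
    exact ⟨α, hγ, rfl⟩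

end IsGradingElement

/-! ### Degrees of roots for an abelian grading -/

/-- The element `x` of the Cartan subalgebra computes the degrees of the roots for `𝓖`, these
degrees are `-1`, `0` or `1`, and those of the simple roots are `0` or `1`. -/
structure IsDegreeElement (b : (rootSystem H).Base) (𝓖 : ℤ → Submodule ℂ L) (x : H) : Prop where
  mem_gradedRoots_iff : ∀ {γ : Dual ℂ H} {i : ℤ}, γ ∈ gradedRoots H 𝓖 i ↔ γ ∈ roots H ∧ γ x = i
  apply_eq : ∀ γ ∈ roots H, γ x = -1 ∨ γ x = 0 ∨ γ x = 1
  simple_apply_eq : ∀ α ∈ simpleRoots b, α x = 0 ∨ α x = 1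

theorem exists_isDegreeElement (b : (rootSystem H).Base) (𝓖 : ℤ → Submodule ℂ L)
    [GradedLieAlgebra 𝓖] (hH : H.toSubmodule ≤ 𝓖 0)
    (hpos : ∀ α ∈ simpleRoots b, ∃ i : ℤ, 0 ≤ i ∧ α ∈ gradedRoots H 𝓖 i)
    (hab : ∀ i : ℤ, i ≠ -1 → i ≠ 0 → i ≠ 1 → 𝓖 i = ⊥) : ∃ x : H, IsDegreeElement b 𝓖 x := by
  obtain ⟨x, hx⟩ := exists_isGradingElement 𝓖 hH
  have key : ∀ γ i, γ ∈ gradedRoots H 𝓖 i → i = -1 ∨ i = 0 ∨ i = 1 := fun γ i hγ ↦ by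
    by_contra! h
    obtain ⟨y, hy, hy'⟩ := exists_ne_zero_mem_rootSpace hγ.1
    have := hγ.2 hy'
    rw [hab i h.1 h.2.1 h.2.2, Submodule.mem_bot] at this
    exact hy this
  refine ⟨x, hx.mem_gradedRoots_iff, fun γ hγ ↦ ?_, fun α hα ↦ ?_⟩
  · obtain ⟨i, hi⟩ := hx.exists_mem_gradedRoots hγ
    rw [(hx.mem_gradedRoots_iff.mp hi).2]
    rcases key γ i hi with rfl | rfl | rfl <;> simp
  · obtain ⟨i, hi, hi'⟩ := hpos α hα
    rw [(hx.mem_gradedRoots_iff.mp hi').2]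
    rcases key α i hi' with rfl | rfl | rfl
    · omega
    · simp
    · simp

namespace IsDegreeElement

variable {b : (rootSystem H).Base} {𝓖 : ℤ → Submodule ℂ L} {x : H}

theorem mem_zero_iff (hx : IsDegreeElement b 𝓖 x) {γ : Dual ℂ H} :
    γ ∈ gradedRoots H 𝓖 0 ↔ γ ∈ roots H ∧ γ x = 0 := by
  rw [hx.mem_gradedRoots_iff, Int.cast_zero]

theorem mem_one_iff (hx : IsDegreeElement b 𝓖 x) {γ : Dual ℂ H} :
    γ ∈ gradedRoots H 𝓖 1 ↔ γ ∈ roots H ∧ γ x = 1 := by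
  rw [hx.mem_gradedRoots_iff, Int.cast_one]

/-- As simple roots have nonnegative degree, only those of degree zero can occur in an element of
degree zero of the positive cone. -/
theorem exists_apply_eq_natCast (hx : IsDegreeElement b 𝓖 x) {v : Dual ℂ H}
    (hv : v ∈ AddSubmonoid.closure (simpleRoots b)) :
    ∃ n : ℕ, v x = n ∧ (n = 0 → v ∈ AddSubmonoid.closure (gradedSimpleRoots b 𝓖 0)) := by
  induction hv using AddSubmonoid.closure_induction with
  | mem v hv =>
    rcases hx.simple_apply_eq v hv with h | h
    · exact ⟨0, by simpa using h, fun _ ↦ AddSubmonoid.subset_closure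
        ⟨hv, hx.mem_zero_iff.mpr ⟨(simpleRoots_subset_posRoots b hv).1, h⟩⟩⟩
    · exact ⟨1, by simpa using h, fun h ↦ (one_ne_zero h).elim⟩
  | zero => exact ⟨0, by simp, fun _ ↦ zero_mem _⟩
  | add u v _ _ hu hv =>
    obtain ⟨n, hn, hn'⟩ := hu
    obtain ⟨m, hm, hm'⟩ := hv
    exact ⟨n + m, by simp [hn, hm], fun h ↦ add_mem (hn' (by omega)) (hm' (by omega))⟩

theorem mem_closure_of_apply_eq_zero (hx : IsDegreeElement b 𝓖 x) {v : Dual ℂ H}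
    (hv : v ∈ AddSubmonoid.closure (simpleRoots b)) (h : v x = 0) :
    v ∈ AddSubmonoid.closure (gradedSimpleRoots b 𝓖 0) := by
  obtain ⟨n, hn, hn'⟩ := hx.exists_apply_eq_natCast hv
  exact hn' (by rw [h] at hn; exact_mod_cast hn.symm)

theorem posRoots_apply (hx : IsDegreeElement b 𝓖 x) {γ : Dual ℂ H} (hγ : γ ∈ posRoots b) :
    γ x = 0 ∨ γ x = 1 := by
  refine (hx.apply_eq γ hγ.1).resolve_left fun h ↦ ?_
  obtain ⟨n, hn, -⟩ := hx.exists_apply_eq_natCast hγ.2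
  rw [h] at hn
  have : (n : ℂ) + 1 = 0 := by rw [← hn]; ring
  exact Nat.cast_add_one_ne_zero n this

theorem mem_posRoots_of_apply_eq_one (hx : IsDegreeElement b 𝓖 x) {γ : Dual ℂ H}
    (hγ : γ ∈ roots H) (h : γ x = 1) : γ ∈ posRoots b := by
  refine (mem_posRoots_or_neg_mem b hγ).resolve_right fun h' ↦ ?_
  have := hx.posRoots_apply h'
  rw [LinearMap.neg_apply, h] at this
  norm_num at this

theorem mem_posRoots_of_mem_one (hx : IsDegreeElement b 𝓖 x) {γ : Dual ℂ H}
    (hγ : γ ∈ gradedRoots H 𝓖 1) : γ ∈ posRoots b :=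
  hx.mem_posRoots_of_apply_eq_one hγ.1 (hx.mem_one_iff.mp hγ).2

/-- If two roots have total degree one, then one of them has degree one and the other zero. -/
theorem apply_eq_of_add_eq_one (hx : IsDegreeElement b 𝓖 x) {γ δ : Dual ℂ H} (hγ : γ ∈ roots H)
    (hδ : δ ∈ roots H) (h : γ x + δ x = 1) : γ x = 1 ∧ δ x = 0 ∨ δ x = 1 ∧ γ x = 0 := by
  rcases hx.apply_eq γ hγ with h₁ | h₁ | h₁ <;> rcases hx.apply_eq δ hδ with h₂ | h₂ | h₂ <;>
    rw [h₁, h₂] at h <;> norm_num at h <;> simp [h₁, h₂]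

/-! ### Minimal coset representatives -/

/-- The group `W(0)` preserves degrees. -/
theorem smul_apply (hx : IsDegreeElement b 𝓖 x) {u : Weyl H} (hu : u ∈ weylZero H 𝓖)
    (v : Dual ℂ H) : (u • v) x = v x := by
  induction hu using Subgroup.closure_induction generalizing v with
  | mem u hu =>
    obtain ⟨i, hi, rfl⟩ := hu
    rw [RootPairing.weylGroup.ofIdx_smul, RootPairing.Equiv.reflection_smul,
      RootPairing.reflection_apply, LinearMap.sub_apply, LinearMap.smul_apply,
      (hx.mem_zero_iff.mp hi).2, smul_zero, sub_zero]
  | one => rw [one_smul]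
  | mul u u' _ _ hu hu' => rw [mul_smul, hu, hu']
  | inv u _ hu => rw [← hu (u⁻¹ • v), smul_inv_smul]

variable {w : Weyl H}

theorem smul_mem_posRoots (hx : IsDegreeElement b 𝓖 x)
    (hw : inversions b w ⊆ gradedRoots H 𝓖 1) {γ : Dual ℂ H} (hγ : γ ∈ posRoots b)
    (h : γ x = 0) : w • γ ∈ posRoots b := by
  by_contra h'
  have := (hx.mem_one_iff.mp (hw (mem_inversions_iff.mpr ⟨hγ, h'⟩))).2
  rw [h] at this
  exact zero_ne_one this

theorem mem_posRoots_of_smul_mem (hx : IsDegreeElement b 𝓖 x)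
    (hw : inversions b w ⊆ gradedRoots H 𝓖 1) {γ : Dual ℂ H} (hγ : w • γ ∈ posRoots b)
    (h : γ x = 0) : γ ∈ posRoots b := by
  refine (mem_posRoots_or_neg_mem b (mem_roots_of_smul_mem w hγ.1)).resolve_right fun h' ↦ ?_
  have := hx.smul_mem_posRoots hw h' (by rw [LinearMap.neg_apply, h, neg_zero])
  rw [smul_neg] at this
  exact neg_notMem_posRoots hγ this

theorem smul_mem_closure (hx : IsDegreeElement b 𝓖 x)
    (hw : inversions b w ⊆ gradedRoots H 𝓖 1) {v : Dual ℂ H}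
    (hv : v ∈ AddSubmonoid.closure (gradedSimpleRoots b 𝓖 0)) :
    w • v ∈ AddSubmonoid.closure (simpleRoots b) := by
  induction hv using AddSubmonoid.closure_induction with
  | mem v hv =>
    exact (hx.smul_mem_posRoots hw (simpleRoots_subset_posRoots b hv.1)
      (hx.mem_zero_iff.mp hv.2).2).2
  | zero => rw [smul_zero]; exact zero_mem _
  | add u v _ _ hu hv => rw [smul_add]; exact add_mem hu hv

/-- The elements of minimal length in their coset of `W(0)` are those with all inversions of
degree one. -/
theorem mem_minReps_iff (hx : IsDegreeElement b 𝓖 x) :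
    w ∈ minReps b 𝓖 ↔ inversions b w ⊆ gradedRoots H 𝓖 1 := by
  constructor
  · intro hw γ hγ
    have hs : ∀ α ∈ gradedSimpleRoots b 𝓖 0, w • α ∈ posRoots b := by
      rintro α ⟨⟨i, hi, rfl⟩, h⟩
      by_contra hneg
      refine (length_mul_refl_lt hi hneg).not_ge (hw _ ?_)
      rw [QuotientGroup.eq, mul_inv_rev, inv_mul_cancel_right, refl_inv]
      exact Subgroup.subset_closure ⟨i, h, rfl⟩
    obtain ⟨h₁, h₂⟩ := mem_inversions_iff.mp hγ
    refine hx.mem_one_iff.mpr ⟨h₁.1, (hx.posRoots_apply h₁).resolve_left fun h ↦ h₂ ?_⟩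
    refine ⟨smul_mem_roots w h₁.1, ?_⟩
    have h₃ := hx.mem_closure_of_apply_eq_zero h₁.2 h
    clear h h₁ h₂ hγ
    induction h₃ using AddSubmonoid.closure_induction with
    | mem v hv => exact (hs v hv).2
    | zero => rw [smul_zero]; exact zero_mem _
    | add u v _ _ hu hv => rw [smul_add]; exact add_mem hu hv
  · intro hw v hv
    have hu : w⁻¹ * v ∈ weylZero H 𝓖 := QuotientGroup.eq.mp hv.symm
    rw [← ncard_inversions, ← ncard_inversions,
      ← Set.ncard_image_of_injective (inversions b w) (MulAction.injective (w⁻¹ * v)⁻¹)]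
    refine Set.ncard_le_ncard ?_ (finite_inversions b v)
    rintro _ ⟨γ, hγ, rfl⟩
    have hγ' := mem_inversions_iff.mp hγ
    refine mem_inversions_iff.mpr ⟨hx.mem_posRoots_of_apply_eq_one (smul_mem_roots _ hγ'.1.1) ?_, ?_⟩
    · rw [hx.smul_apply (inv_mem hu)]
      exact (hx.mem_one_iff.mp (hw hγ)).2
    · dsimp only
      rw [← mul_smul, mul_inv_rev, inv_inv, mul_inv_cancel_left]
      exact hγ'.2

/-- A coset of `W(0)` has only one element of minimal length: if `v` and `w` are two of them, then
`v⁻¹ * w` preserves degrees, and the signs of the roots of degree zero, so it has no inversion. -/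
theorem eq_of_mem_minReps (hx : IsDegreeElement b 𝓖 x) {v : Weyl H} (hv : v ∈ minReps b 𝓖)
    (hw : w ∈ minReps b 𝓖) (h : (v : Weyl H ⧸ weylZero H 𝓖) = w) : v = w := by
  have hu : v⁻¹ * w ∈ weylZero H 𝓖 := QuotientGroup.eq.mp h
  refine inv_mul_eq_one.mp (eq_one_of_inversions_eq_empty (b := b) ?_)
  refine Set.eq_empty_iff_forall_notMem.mpr fun γ hγ ↦ ?_
  obtain ⟨h₁, h₂⟩ := mem_inversions_iff.mp hγ
  rcases hx.posRoots_apply h₁ with h₀ | h₀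
  · refine h₂ (hx.mem_posRoots_of_smul_mem (hx.mem_minReps_iff.mp hv) ?_
      (by rw [hx.smul_apply hu, h₀]))
    rw [← mul_smul, mul_inv_cancel_left]
    exact hx.smul_mem_posRoots (hx.mem_minReps_iff.mp hw) h₁ h₀
  · exact h₂ (hx.mem_posRoots_of_apply_eq_one (smul_mem_roots _ h₁.1)
      (by rw [hx.smul_apply hu, h₀]))

end IsDegreeElement

theorem exists_mem_minReps (b : (rootSystem H).Base) (𝓖 : ℤ → Submodule ℂ L)
    (q : Weyl H ⧸ weylZero H 𝓖) : ∃ w ∈ minReps b 𝓖, (w : Weyl H ⧸ weylZero H 𝓖) = q := by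
  obtain ⟨w, hw⟩ : ∃ w : Weyl H, (w : Weyl H ⧸ weylZero H 𝓖) = q := Quotient.exists_rep q
  obtain ⟨v, hv, hv'⟩ := (InvImage.wf (length b) Nat.lt_wfRel.wf).has_min
    {v : Weyl H | (v : Weyl H ⧸ weylZero H 𝓖) = q} ⟨w, hw⟩
  exact ⟨v, fun u hu ↦ not_lt.mp (hv' u (hu.trans hv)), hv⟩

/-! ### The ideal and the antichain of a minimal coset representative -/

section Ideals

variable {b : (rootSystem H).Base} {𝓖 : ℤ → Submodule ℂ L}

theorem WeightPoset.le_iff {μ γ : WeightPoset b 𝓖 1} :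
    μ ≤ γ ↔ γ.1 - μ.1 ∈ AddSubmonoid.closure (gradedSimpleRoots b 𝓖 0) := Iff.rfl

instance : Finite (WeightPoset b 𝓖 1) :=
  (finite_roots.subset fun _ h ↦ h.1 : (gradedRoots H 𝓖 1).Finite).to_subtype

end Ideals

namespace IsDegreeElement

variable {b : (rootSystem H).Base} {𝓖 : ℤ → Submodule ℂ L} {x : H} {w : Weyl H}
  {γ : WeightPoset b 𝓖 1}

theorem mem_inDeltaOne_inversions_iff (hx : IsDegreeElement b 𝓖 x) :
    γ ∈ inDeltaOne b 𝓖 (inversions b w) ↔ w • γ.1 ∉ posRoots b :=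
  mem_inversions_iff.trans (and_iff_right (hx.mem_posRoots_of_mem_one γ.2))

theorem mem_idealOf_iff (hx : IsDegreeElement b 𝓖 x) :
    γ ∈ idealOf b 𝓖 w ↔ w • γ.1 ∈ posRoots b := by
  rw [idealOf, Set.mem_compl_iff, hx.mem_inDeltaOne_inversions_iff, not_not]

theorem isUpperSet_idealOf (hx : IsDegreeElement b 𝓖 x) (hw : w ∈ minReps b 𝓖) :
    IsUpperSet (idealOf b 𝓖 w) := by
  intro γ δ hle hγ
  rw [hx.mem_idealOf_iff] at hγ ⊢
  refine ⟨smul_mem_roots w δ.2.1, ?_⟩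
  have := add_mem hγ.2 (hx.smul_mem_closure (hx.mem_minReps_iff.mp hw) (WeightPoset.le_iff.mp hle))
  rwa [← smul_add, add_sub_cancel] at this

/-- Let `γ` have degree one and let the positive root `ε = c (w γ)`, `c = ±1`, not be simple. A
decomposition of `ε` into positive roots splits `γ` into a root `δ` of degree one, for which `w δ`
has the same sign as `w γ`, and a root `γ - δ` of degree zero, which has the sign `c` because `w`
preserves the signs of the roots of degree zero. So `γ` is neither minimal in `I_w` (for `c = 1`)
nor maximal in `N(w)` (for `c = -1`). -/
theorem exists_split (hx : IsDegreeElement b 𝓖 x) (hw : w ∈ minReps b 𝓖) {ε : Dual ℂ H}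
    (hε : ε ∈ posRoots b) (hs : ε ∉ simpleRoots b) {γ : Dual ℂ H} {c : ℤˣ} (hγ : γ x = 1)
    (hc : w • γ = c • ε) : ∃ δ ∈ gradedRoots H 𝓖 1, ∃ β ∈ posRoots b, w • δ = c • β ∧
      γ ≠ δ ∧ c • (γ - δ) ∈ AddSubmonoid.closure (gradedSimpleRoots b 𝓖 0) := by
  have hcr : ∀ {η : Dual ℂ H}, η ∈ roots H → c • η ∈ roots H := fun {η} hη ↦ by
    rcases Int.units_eq_one_or c with rfl | rfl
    · rwa [one_smul]
    · rw [Units.neg_smul, one_smul]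
      exact neg_mem_roots hη
  have hcc : ∀ η : Dual ℂ H, c • c • η = η := fun η ↦ by
    rw [← mul_smul, Int.units_mul_self, one_smul]
  have hcw : ∀ η : Dual ℂ H, c • w • η = w • c • η := fun η ↦ by
    rcases Int.units_eq_one_or c with rfl | rfl
    · rw [one_smul, one_smul]
    · rw [Units.neg_smul, one_smul, Units.neg_smul, one_smul, smul_neg]
  obtain ⟨β₁, hβ₁, β₂, hβ₂, rfl⟩ := exists_eq_add_of_notMem_simpleRoots hε hs
  have key : ∀ β ∈ posRoots b, ∀ β' ∈ posRoots b, w • γ = c • (β + β') →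
      (w⁻¹ • c • β) x = 1 → (w⁻¹ • c • β') x = 0 → ∃ δ ∈ gradedRoots H 𝓖 1,
        ∃ β ∈ posRoots b, w • δ = c • β ∧ γ ≠ δ ∧
          c • (γ - δ) ∈ AddSubmonoid.closure (gradedSimpleRoots b 𝓖 0) := by
    intro β hβ β' hβ' h h₁ h₀
    have hδ : γ - w⁻¹ • c • β = w⁻¹ • c • β' := by
      rw [sub_eq_iff_eq_add', eq_comm, ← smul_add, ← smul_add, ← h, inv_smul_smul]
    have hδ' : w • c • w⁻¹ • c • β' = β' := by
      rw [← hcw, smul_inv_smul, hcc]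
    have hx0 : (c • w⁻¹ • c • β') x = 0 := by
      rcases Int.units_eq_one_or c with rfl | rfl
      · rwa [one_smul]
      · rw [Units.neg_smul, one_smul, LinearMap.neg_apply, h₀, neg_zero]
    refine ⟨w⁻¹ • c • β, hx.mem_one_iff.mpr ⟨smul_mem_roots _ (hcr hβ.1), h₁⟩, β, hβ,
      smul_inv_smul _ _, fun h' ↦ ?_, ?_⟩
    · rw [← h', sub_self] at hδ
      exact ne_zero_of_mem_roots (smul_mem_roots w⁻¹ (hcr hβ'.1)) hδ.symm
    · rw [hδ]
      exact hx.mem_closure_of_apply_eq_zero (hx.mem_posRoots_of_smul_mem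
        (hx.mem_minReps_iff.mp hw) (by rwa [hδ']) hx0).2 hx0
  have hsum : (w⁻¹ • c • β₁) x + (w⁻¹ • c • β₂) x = 1 := by
    rw [← LinearMap.add_apply, ← smul_add, ← smul_add, ← hc, inv_smul_smul, hγ]
  rcases hx.apply_eq_of_add_eq_one (smul_mem_roots _ (hcr hβ₁.1))
    (smul_mem_roots _ (hcr hβ₂.1)) hsum with ⟨h₁, h₀⟩ | ⟨h₁, h₀⟩
  · exact key β₁ hβ₁ β₂ hβ₂ hc h₁ h₀
  · exact key β₂ hβ₂ β₁ hβ₁ (by rw [hc, add_comm]) h₁ h₀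

theorem mem_minElts_idealOf_iff (hx : IsDegreeElement b 𝓖 x) (hw : w ∈ minReps b 𝓖)
    (hγ : γ ∈ idealOf b 𝓖 w) :
    γ ∈ minElts (idealOf b 𝓖 w) ↔ w • γ.1 ∈ simpleRoots b := by
  constructor
  · intro hmin
    by_contra hs
    obtain ⟨δ, hδ, β, hβ, hwδ, hne, hle⟩ := hx.exists_split hw (hx.mem_idealOf_iff.mp hγ) hs
      (hx.mem_one_iff.mp γ.2).2 (c := 1) (one_smul _ _).symm
    rw [one_smul] at hwδ hle
    have hδ' : (⟨δ, hδ⟩ : WeightPoset b 𝓖 1) ∈ idealOf b 𝓖 w :=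
      hx.mem_idealOf_iff.mpr (by rwa [hwδ])
    exact hne (congrArg Subtype.val (hmin.eq_of_le hδ' (WeightPoset.le_iff.mpr hle))).symm
  · refine fun hs ↦ ⟨hγ, fun μ hμ hle ↦ ?_⟩
    have h₁ := hx.mem_idealOf_iff.mp hμ
    have h₂ := hx.smul_mem_closure (hx.mem_minReps_iff.mp hw) (WeightPoset.le_iff.mp hle)
    rcases eq_zero_or_eq_zero_of_add_mem_simpleRoots h₁.2 h₂
      (by rwa [← smul_add, add_sub_cancel]) with h | h
    · exact (ne_zero_of_mem_roots h₁.1 h).elim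
    · rw [smul_eq_zero_iff_eq, sub_eq_zero] at h
      exact le_of_eq (Subtype.ext h)

theorem antichainOf_eq (hx : IsDegreeElement b 𝓖 x) (hw : w ∈ minReps b 𝓖) :
    antichainOf b 𝓖 w = inDeltaOne b 𝓖 (w⁻¹ • simpleRoots b) := by
  ext γ
  change γ ∈ minElts (idealOf b 𝓖 w) ↔ γ.1 ∈ w⁻¹ • simpleRoots b
  rw [Set.mem_inv_smul_set_iff]
  refine ⟨fun h ↦ (hx.mem_minElts_idealOf_iff hw h.1).mp h, fun h ↦ ?_⟩
  exact (hx.mem_minElts_idealOf_iff hw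
    (hx.mem_idealOf_iff.mpr (simpleRoots_subset_posRoots b h))).mpr h

theorem mem_maxElts_inversions_iff (hx : IsDegreeElement b 𝓖 x) (hw : w ∈ minReps b 𝓖)
    (hγ : γ ∈ inDeltaOne b 𝓖 (inversions b w)) :
    γ ∈ maxElts (inDeltaOne b 𝓖 (inversions b w)) ↔ w • γ.1 ∈ -simpleRoots b := by
  have hγ' : -(w • γ.1) ∈ posRoots b := hγ.2
  rw [Set.mem_neg]
  constructor
  · intro hmax
    by_contra hs
    obtain ⟨δ, hδ, β, hβ, hwδ, hne, hle⟩ := hx.exists_split hw hγ' hs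
      (hx.mem_one_iff.mp γ.2).2 (c := -1) (by rw [Units.neg_smul, one_smul, neg_neg])
    rw [Units.neg_smul, one_smul] at hwδ hle
    rw [neg_sub] at hle
    have hδ' : (⟨δ, hδ⟩ : WeightPoset b 𝓖 1) ∈ inDeltaOne b 𝓖 (inversions b w) :=
      hx.mem_inDeltaOne_inversions_iff.mpr (by rw [hwδ]; exact neg_notMem_posRoots hβ)
    exact hne (congrArg Subtype.val (hmax.eq_of_ge hδ' (WeightPoset.le_iff.mpr hle))).symm
  · refine fun hs ↦ ⟨hγ, fun μ hμ hle ↦ ?_⟩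
    have h₁ : -(w • μ.1) ∈ posRoots b := hμ.2
    have h₂ := hx.smul_mem_closure (hx.mem_minReps_iff.mp hw) (WeightPoset.le_iff.mp hle)
    rcases eq_zero_or_eq_zero_of_add_mem_simpleRoots h₁.2 h₂
      (by rwa [smul_sub, neg_add_eq_sub, sub_sub_cancel_left]) with h | h
    · exact (ne_zero_of_mem_roots h₁.1 h).elim
    · rw [smul_eq_zero_iff_eq, sub_eq_zero] at h
      exact le_of_eq (Subtype.ext h)

theorem maxElts_inversions_eq (hx : IsDegreeElement b 𝓖 x) (hw : w ∈ minReps b 𝓖) :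
    maxElts (inDeltaOne b 𝓖 (inversions b w)) =
      inDeltaOne b 𝓖 (-(w⁻¹ • simpleRoots b)) := by
  ext γ
  change _ ↔ -γ.1 ∈ w⁻¹ • simpleRoots b
  rw [Set.mem_inv_smul_set_iff, smul_neg, ← Set.mem_neg]
  refine ⟨fun h ↦ (hx.mem_maxElts_inversions_iff hw h.1).mp h, fun h ↦ ?_⟩
  refine (hx.mem_maxElts_inversions_iff hw ?_).mpr h
  rw [hx.mem_inDeltaOne_inversions_iff, ← neg_mem_posRoots_iff (smul_mem_roots w γ.2.1)]
  exact simpleRoots_subset_posRoots b h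

/-! ### The bijection with antichains -/

theorem idealOf_injOn (hx : IsDegreeElement b 𝓖 x) :
    Set.InjOn (idealOf b 𝓖) (minReps b 𝓖) := by
  intro v hv w hw h
  have h' : inDeltaOne b 𝓖 (inversions b v) = inDeltaOne b 𝓖 (inversions b w) :=
    compl_injective h
  refine inversions_injective b (Set.ext fun γ ↦ ⟨fun hγ ↦ ?_, fun hγ ↦ ?_⟩)
  · exact (Set.ext_iff.mp h' ⟨γ, hx.mem_minReps_iff.mp hv hγ⟩).mp hγ
  · exact (Set.ext_iff.mp h' ⟨γ, hx.mem_minReps_iff.mp hw hγ⟩).mpr hγ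

/-- If `γ` is minimal in `I_w`, so that `α = w γ` is simple, then `I_{s_α w} = I_w ∖ {γ}`. -/
theorem idealOf_refl_mul (hx : IsDegreeElement b 𝓖 x) (hw : w ∈ minReps b 𝓖) {i : H.root}
    (hi : i ∈ b.support) (hγ : w • γ.1 = (rootSystem H).root i) :
    refl i * w ∈ minReps b 𝓖 ∧ idealOf b 𝓖 (refl i * w) = idealOf b 𝓖 w \ {γ} := by
  have hinj : ∀ {δ : Dual ℂ H}, w • δ = (rootSystem H).root i → δ = γ.1 := fun h ↦
    MulAction.injective w (h.trans hγ.symm)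
  constructor
  · rw [hx.mem_minReps_iff]
    intro δ hδ
    obtain ⟨h₁, h₂⟩ := mem_inversions_iff.mp hδ
    refine hx.mem_one_iff.mpr ⟨h₁.1, (hx.posRoots_apply h₁).resolve_left fun h ↦ h₂ ?_⟩
    rw [mul_smul]
    refine refl_smul_mem_posRoots hi (hx.smul_mem_posRoots (hx.mem_minReps_iff.mp hw) h₁ h) ?_
    intro h'
    rw [hinj h', (hx.mem_one_iff.mp γ.2).2] at h
    exact one_ne_zero h
  · ext μ
    rw [Set.mem_sdiff, Set.mem_singleton_iff, hx.mem_idealOf_iff, hx.mem_idealOf_iff, mul_smul]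
    constructor
    · intro h
      have hne : μ ≠ γ := by
        rintro rfl
        rw [hγ, refl_smul_root] at h
        exact neg_notMem_posRoots (simpleRoots_subset_posRoots b ⟨i, hi, rfl⟩) h
      refine ⟨?_, hne⟩
      rw [← refl_smul_refl_smul i (w • μ.1)]
      refine refl_smul_mem_posRoots hi h fun h' ↦ ?_
      -- otherwise `μ = -γ`, which has degree `-1`
      have h₁ : w • μ.1 = -(rootSystem H).root i := by
        rw [← refl_smul_root, ← h', refl_smul_refl_smul]
      have h₂ : -μ.1 = γ.1 := hinj (by rw [smul_neg, h₁, neg_neg])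
      have h₃ := (hx.mem_one_iff.mp γ.2).2
      rw [← h₂, LinearMap.neg_apply, (hx.mem_one_iff.mp μ.2).2] at h₃
      norm_num at h₃
    · rintro ⟨h, hne⟩
      exact refl_smul_mem_posRoots hi h fun h' ↦ hne (Subtype.ext (hinj h'))

/-- Every upper ideal is some `I_w`, by induction on the size of its complement: a maximal element
`γ` of the complement is minimal in the ideal enlarged by `γ`. -/
theorem exists_idealOf_eq (hx : IsDegreeElement b 𝓖 x) (I : Set (WeightPoset b 𝓖 1))
    (hI : IsUpperSet I) : ∃ w ∈ minReps b 𝓖, idealOf b 𝓖 w = I := by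
  induction hn : Iᶜ.ncard generalizing I with
  | zero =>
    have hI' : I = Set.univ := by
      rwa [Set.ncard_eq_zero (Set.toFinite _), Set.compl_empty_iff] at hn
    refine ⟨1, hx.mem_minReps_iff.mpr (by rw [inversions_one]; exact Set.empty_subset _), ?_⟩
    rw [hI', Set.eq_univ_iff_forall]
    intro γ
    rw [hx.mem_idealOf_iff, one_smul]
    exact hx.mem_posRoots_of_mem_one γ.2
  | succ n ih =>
    obtain ⟨γ, hγ⟩ := (Set.toFinite Iᶜ).exists_maximal
      (Set.nonempty_of_ncard_ne_zero (by omega))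
    have hup : IsUpperSet (insert γ I) := by
      rintro μ ν hle (rfl | hμ)
      · by_cases hν : ν ∈ I
        · exact Or.inr hν
        · exact Or.inl (hγ.eq_of_ge hν hle)
      · exact Or.inr (hI hle hμ)
    obtain ⟨w, hw, hwI⟩ := ih (insert γ I) hup (by
      rw [← Set.union_singleton, Set.compl_union, ← Set.sdiff_eq, Set.ncard_sdiff_singleton_of_mem
        hγ.prop, hn, Nat.add_sub_cancel])
    have hmin : γ ∈ minElts (idealOf b 𝓖 w) := by
      rw [hwI]
      refine ⟨Set.mem_insert _ _, ?_⟩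
      rintro μ (rfl | hμ) hle
      · exact le_rfl
      · exact (hγ.prop (hI hle hμ)).elim
    obtain ⟨i, hi, hi'⟩ := (hx.mem_minElts_idealOf_iff hw hmin.prop).mp hmin
    obtain ⟨h₁, h₂⟩ := hx.idealOf_refl_mul hw hi hi'.symm
    refine ⟨_, h₁, ?_⟩
    rw [h₂, hwI, Set.insert_sdiff_self_of_notMem hγ.prop]

theorem bijOn_antichainOf (hx : IsDegreeElement b 𝓖 x) :
    Set.BijOn (antichainOf b 𝓖) (minReps b 𝓖) (antichains (WeightPoset b 𝓖 1)) := by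
  refine ⟨fun w _ ↦ setOfPred_minimal_antichain _, fun v hv w hw h ↦ ?_, fun A hA ↦ ?_⟩
  · have key : ∀ u ∈ minReps b 𝓖, idealOf b 𝓖 u = upperClosure (antichainOf b 𝓖 u) := by
      intro u hu
      refine Set.Subset.antisymm (fun γ hγ ↦ ?_)
        (upperClosure_min (fun γ hγ ↦ hγ.prop) (hx.isUpperSet_idealOf hu))
      obtain ⟨μ, hμ, hμ'⟩ := (Set.toFinite (idealOf b 𝓖 u)).exists_le_minimal hγ
      exact ⟨μ, hμ', hμ⟩
    exact hx.idealOf_injOn hv hw (by rw [key v hv, key w hw, h])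
  · obtain ⟨w, hw, hwA⟩ := hx.exists_idealOf_eq _ (upperClosure A).upper
    refine ⟨w, hw, Set.ext fun γ ↦ ?_⟩
    change Minimal (· ∈ idealOf b 𝓖 w) γ ↔ γ ∈ A
    rw [hwA]
    exact hA.minimal_mem_upperClosure_iff_mem

theorem ncard_idealOf_add_length (hx : IsDegreeElement b 𝓖 x) (hw : w ∈ minReps b 𝓖) :
    (idealOf b 𝓖 w).ncard + length b w = (gradedRoots H 𝓖 1).ncard := by
  have h : (inDeltaOne b 𝓖 (inversions b w)).ncard = length b w := by
    rw [← ncard_inversions]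
    refine Set.ncard_preimage_of_injective_subset_range (f := Subtype.val)
      Subtype.val_injective ?_
    rw [Subtype.range_val]
    exact hx.mem_minReps_iff.mp hw
  rw [← h, add_comm, idealOf, Set.ncard_add_ncard_compl]
  exact Nat.card_coe_set_eq _

theorem ncard_minReps (hx : IsDegreeElement b 𝓖 x) :
    (minReps b 𝓖).ncard = Nat.card (Weyl H ⧸ weylZero H 𝓖) := by
  rw [← Nat.card_coe_set_eq]
  refine Nat.card_eq_of_bijective
    (fun w : minReps b 𝓖 ↦ ((w : Weyl H) : Weyl H ⧸ weylZero H 𝓖)) ⟨fun v w h ↦ ?_, fun q ↦ ?_⟩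
  · exact Subtype.ext (hx.eq_of_mem_minReps v.2 w.2 h)
  · obtain ⟨w, hw, hq⟩ := exists_mem_minReps b 𝓖 q
    exact ⟨⟨w, hw⟩, hq⟩

end IsDegreeElement

end GradedRoots

theorem theorem3p1 {L : Type*} [LieRing L] [LieAlgebra ℂ L] [FiniteDimensional ℂ L]
    [LieAlgebra.IsSimple ℂ L]
    -- a Cartan subalgebra, a choice of simple roots
    (H : LieSubalgebra ℂ L) [H.IsCartanSubalgebra]
    (b : (LieAlgebra.IsKilling.rootSystem H).Base)
    -- a grading with `𝔱 ⊆ 𝔤(0)` in which all simple roots have nonnegative degree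
    (𝓖 : ℤ → Submodule ℂ L) [GradedLieAlgebra 𝓖]
    (hH : H.toSubmodule ≤ 𝓖 0)
    (hpos : ∀ α ∈ GradedRoots.simpleRoots b, ∃ i : ℤ, 0 ≤ i ∧ α ∈ GradedRoots.gradedRoots H 𝓖 i)
    -- the grading is abelian
    (hab : ∀ i : ℤ, i ≠ -1 → i ≠ 0 → i ≠ 1 → 𝓖 i = ⊥) :
    Set.BijOn (GradedRoots.antichainOf b 𝓖) (GradedRoots.minReps b 𝓖)
        (GradedRoots.antichains (GradedRoots.WeightPoset b 𝓖 1)) ∧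
    (∀ w ∈ GradedRoots.minReps b 𝓖,
      -- (i)
      IsUpperSet (GradedRoots.idealOf b 𝓖 w) ∧
      -- (ii)
      (∀ γ ∈ GradedRoots.idealOf b 𝓖 w,
        (γ ∈ GradedRoots.minElts (GradedRoots.idealOf b 𝓖 w) ↔
          w • γ.1 ∈ GradedRoots.simpleRoots b)) ∧
      GradedRoots.antichainOf b 𝓖 w =
        GradedRoots.inDeltaOne b 𝓖 (w⁻¹ • GradedRoots.simpleRoots b) ∧
      -- (iii)
      GradedRoots.inversions b w ⊆ GradedRoots.gradedRoots H 𝓖 1 ∧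
      (∀ γ ∈ GradedRoots.inDeltaOne b 𝓖 (GradedRoots.inversions b w),
        (γ ∈ GradedRoots.maxElts (GradedRoots.inDeltaOne b 𝓖 (GradedRoots.inversions b w)) ↔
          w • γ.1 ∈ -GradedRoots.simpleRoots b)) ∧
      GradedRoots.maxElts (GradedRoots.inDeltaOne b 𝓖 (GradedRoots.inversions b w)) =
        GradedRoots.maxElts (GradedRoots.idealOf b 𝓖 w)ᶜ ∧
      GradedRoots.maxElts (GradedRoots.inDeltaOne b 𝓖 (GradedRoots.inversions b w)) =
        GradedRoots.inDeltaOne b 𝓖 (-(w⁻¹ • GradedRoots.simpleRoots b)) ∧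
      -- the cardinality of `I_w`
      ((GradedRoots.idealOf b 𝓖 w).ncard : ℤ) =
        Module.finrank ℂ (𝓖 1) - GradedRoots.length b w) ∧
    -- the number of antichains
    (GradedRoots.antichains (GradedRoots.WeightPoset b 𝓖 1)).ncard =
      Nat.card (GradedRoots.Weyl H ⧸ GradedRoots.weylZero H 𝓖) := by
  obtain ⟨x, hx⟩ := GradedRoots.exists_isGradingElement 𝓖 hH
  have hfin := hx.finrank_eq hH one_ne_zero
  clear hx x
  obtain ⟨x, hx⟩ := GradedRoots.exists_isDegreeElement b 𝓖 hH hpos hab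
  refine ⟨hx.bijOn_antichainOf, fun w hw ↦ ⟨hx.isUpperSet_idealOf hw,
    fun γ hγ ↦ hx.mem_minElts_idealOf_iff hw hγ, hx.antichainOf_eq hw, hx.mem_minReps_iff.mp hw,
    fun γ hγ ↦ hx.mem_maxElts_inversions_iff hw hγ, ?_, hx.maxElts_inversions_eq hw, ?_⟩, ?_⟩
  · rw [GradedRoots.idealOf, compl_compl]
  · rw [hfin, ← hx.ncard_idealOf_add_length hw]
    push_cast
    ring
  · rw [← hx.bijOn_antichainOf.image_eq, hx.bijOn_antichainOf.injOn.ncard_image,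
      hx.ncard_minReps]
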